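/- Let $\alpha=\{\alpha_{\mathbf k}\}$ and $\beta=\{\beta_{\mathbf k}\}$ be bounded families of positive real numbers indexed by $\mathbf k=(k_1,k_2)\in\mathbb Z_+^2$, where $\mathbb Z_+=\{0,1,2,\dots\}$, and let $\mathbf T=(T_1,T_2)$ be the associated 2-variable weighted shift on $\ell^2(\mathbb Z_+^2)$ (complex sequences, canonical orthonormal basis $\{e_{\mathbf k}\}$): $T_1e_{\mathbf k}=\alpha_{\mathbf k}e_{\mathbf k+\varepsilon_1}$, $T_2e_{\mathbf k}=\beta_{\mathbf k}e_{\mathbf k+\varepsilon_2}$, with $\varepsilon_1=(1,0)$, $\varepsilon_2=(0,1)$. Write $[S,T]=ST-TS$. An operator $T$ is hyponormal if $[T^*,T]\ge 0$; quadratically hyponormal if $p(T)$ is hyponormal for every complex polynomial $p$ of degree at most $2$; subnormal if it is the restriction of a normal operator to an invariant subspace. The pair $\mathbf T$ is hyponormal if $T_1T_2=T_2T_1$ and the operator matrix $\big([T_j^*,T_i]\big)_{i,j=1}^2$ is positive; it is subnormal if it is the restriction of a pair of commuting normal operators to a common invariant subspace. $\mathbf T$ is horizontally flat if $\alpha_{(k_1,k_2)}=\alpha_{(1,1)}$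 for all $k_1,k_2\ge1$, and vertically flat if $\beta_{(k_1,k_2)}=\beta_{(1,1)}$ for all $k_1,k_2\ge1$. (a) Suppose that $\mathbf T$ is commuting and hyponormal. (i) If $T_1$ is quadratically hyponormal, $T_2$ is subnormal, and $\alpha_{(k_1,k_2)+\varepsilon_1}=\alpha_{(k_1,k_2)}$ for some $k_1\ge1$ and $k_2\ge0$, then $\mathbf T$ is horizontally flat. (ii) If $T_1$ is subnormal, $T_2$ is quadratically hyponormal, and $\beta_{(k_1,k_2)+\varepsilon_2}=\beta_{(k_1,k_2)}$ for some $k_1\ge0$ and $k_2\ge1$, then $\mathbf T$ is vertically flat. (b) Suppose that $\mathbf T$ is subnormal. (i) If $\alpha_{(k_1,k_2)+\varepsilon_1}=\alpha_{(k_1,k_2)}$ for some $k_1,k_2\ge0$, then $\mathbf T$ is horizontally flat. (ii) If $\beta_{(k_1,k_2)+\varepsilon_2}=\beta_{(k_1,k_2)}$ for some $k_1,k_2\ge0$, then $\mathbf T$ is vertically flat. -/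

import Mathlib

open scoped ENNReal ComplexOrder

noncomputable section

/-! ### Classes of operators on a complex Hilbert space -/

section Operators

universe u

variable {H : Type u} [NormedAddCommGroup H] [InnerProductSpace ℂ H] [CompleteSpace H]

/-- The commutator `[S, T] = S T - T S`. -/
def opComm (S T : H →L[ℂ] H) : H →L[ℂ] H := S * T - T * S

/-- `T` is hyponormal: `T* T ≥ T T*`. -/
def IsHyponormal (T : H →L[ℂ] H) : Prop :=
  (opComm (ContinuousLinearMap.adjoint T) T).IsPositive

/-- `T` is quadratically hyponormal (weakly `2`-hyponormal): `p(T)` is hyponormal for every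
complex polynomial `p` of degree at most two. -/
def IsQuadraticallyHyponormal (T : H →L[ℂ] H) : Prop :=
  ∀ p : Polynomial ℂ, p.natDegree ≤ 2 → IsHyponormal (Polynomial.aeval T p)

/-- `T` is subnormal: it is (up to the isometric identification `V` of `H` with a subspace of `K`)
the restriction of a normal operator `N` on a Hilbert space `K` to an invariant subspace. -/
def IsSubnormal (T : H →L[ℂ] H) : Prop :=
  ∃ (K : Type u) (_ : NormedAddCommGroup K) (_ : InnerProductSpace ℂ K) (_ : CompleteSpace K)
    (N : K →L[ℂ] K) (V : H →ₗᵢ[ℂ] K), IsStarNormal N ∧ ∀ x, N (V x) = V (T x)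

/-- Positivity, on the direct sum of `n` copies of `H`, of an `n × n` matrix of operators:
`∑ i, ⟪x i, (M x) i⟫ ≥ 0` (real and nonnegative) for every vector `x`. -/
def OpMatrixPositive {n : ℕ} (M : Fin n → Fin n → (H →L[ℂ] H)) : Prop :=
  ∀ x : Fin n → H, (0 : ℂ) ≤ ∑ i, inner ℂ (x i) (∑ j, M i j (x j))

/-- The tuple `T` is (jointly) hyponormal: its members commute and the operator matrix
`[T*, T]`, with `(i, j)` entry `[(T j)*, T i]`, is positive. -/
def IsJointlyHyponormal {n : ℕ} (T : Fin n → (H →L[ℂ] H)) : Prop :=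
  (∀ i j, Commute (T i) (T j)) ∧
    OpMatrixPositive fun i j => opComm (ContinuousLinearMap.adjoint (T j)) (T i)

/-- The tuple `T` is (jointly) subnormal: it is the restriction of a tuple of commuting normal
operators to a common invariant subspace. -/
def IsJointlySubnormal {n : ℕ} (T : Fin n → (H →L[ℂ] H)) : Prop :=
  ∃ (K : Type u) (_ : NormedAddCommGroup K) (_ : InnerProductSpace ℂ K) (_ : CompleteSpace K)
    (N : Fin n → (K →L[ℂ] K)) (V : H →ₗᵢ[ℂ] K),
    (∀ i j, Commute (N i) (N j)) ∧ (∀ i, IsStarNormal (N i)) ∧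
      ∀ i x, N i (V x) = V (T i x)

end Operators

/-! ### Two-variable weighted shifts -/

/-- The Hilbert space `ℓ²(ℤ₊²)` of square-summable complex families indexed by `ℤ₊²`. -/
abbrev EllTwo : Type := lp (fun _ : ℕ × ℕ => ℂ) 2

/-- Bounded real weight families, the elements of `ℓ^∞(ℤ₊²)`. -/
abbrev WeightFamily : Type := lp (fun _ : ℕ × ℕ => ℝ) ∞

/-- The coordinates of the shifted vector: `f k` is multiplied by `w k` and moved from position
`k` to position `k + e`; positions not of the form `k + e` get `0`. -/
def shiftFun (w : WeightFamily) (e : ℕ × ℕ) (f : ℕ × ℕ → ℂ) : ℕ × ℕ → ℂ :=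
  Function.extend (fun k : ℕ × ℕ => k + e) (fun k => (w k : ℂ) * f k) 0

theorem shiftFun_add (w : WeightFamily) (e : ℕ × ℕ) (f : ℕ × ℕ → ℂ) (k : ℕ × ℕ) :
    shiftFun w e f (k + e) = (w k : ℂ) * f k :=
  (add_left_injective e).extend_apply _ _ k

theorem shiftFun_hasSum (w : WeightFamily) (e : ℕ × ℕ) (f : EllTwo) :
    ∃ s : ℝ, HasSum (fun k => ‖shiftFun w e f k‖ ^ (2 : ℝ)) s ∧ s ≤ (‖w‖ * ‖f‖) ^ (2 : ℝ) := by
  have hf := lp.hasSum_norm (p := 2) (by norm_num) f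
  have h2 : ((2 : ℝ≥0∞).toReal) = 2 := by norm_num
  rw [h2] at hf
  have hb : ∀ k, ‖(w k : ℂ) * f k‖ ^ (2 : ℝ) ≤ ‖w‖ ^ (2 : ℝ) * ‖f k‖ ^ (2 : ℝ) := by
    intro k
    rw [norm_mul, Complex.norm_real, Real.mul_rpow (norm_nonneg _) (norm_nonneg _)]
    gcongr
    exact lp.norm_apply_le_norm (by norm_num) w k
  have hs : Summable fun k => ‖(w k : ℂ) * f k‖ ^ (2 : ℝ) :=
    Summable.of_nonneg_of_le (fun k => by positivity) hb (hf.summable.mul_left _)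
  refine ⟨∑' k, ‖(w k : ℂ) * f k‖ ^ (2 : ℝ), ?_, ?_⟩
  · rw [← (add_left_injective e).hasSum_iff]
    · convert hs.hasSum using 2 with k
      simp only [Function.comp, shiftFun_add]
    · intro k hk
      have : shiftFun w e f k = 0 := Function.extend_apply' _ _ _ fun ⟨a, ha⟩ => hk ⟨a, ha⟩
      simp [this]
  · rw [Real.mul_rpow (norm_nonneg _) (norm_nonneg _), ← hf.tsum_eq, ← tsum_mul_left]
    exact hs.tsum_le_tsum hb (hf.summable.mul_left _)

theorem shiftFun_memℓp (w : WeightFamily) (e : ℕ × ℕ) (f : EllTwo) :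
    Memℓp (shiftFun w e f) 2 := by
  obtain ⟨s, hs, -⟩ := shiftFun_hasSum w e f
  refine memℓp_gen ?_
  simpa using hs.summable

/-- The bounded operator on `ℓ²(ℤ₊²)` with `e_k ↦ w_k e_{k + e}` for all `k`. -/
def weightedShift (w : WeightFamily) (e : ℕ × ℕ) : EllTwo →L[ℂ] EllTwo :=
  LinearMap.mkContinuous
    { toFun := fun f => ⟨shiftFun w e f, shiftFun_memℓp w e f⟩
      map_add' := fun f g => by
        ext k
        change shiftFun w e (⇑f + ⇑g) k = shiftFun w e f k + shiftFun w e g k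
        by_cases hk : ∃ a, a + e = k
        · obtain ⟨a, rfl⟩ := hk
          simp [shiftFun_add, mul_add]
        · simp [shiftFun, Function.extend_apply' _ _ _ hk]
      map_smul' := fun c f => by
        ext k
        change shiftFun w e (c • ⇑f) k = c * shiftFun w e f k
        by_cases hk : ∃ a, a + e = k
        · obtain ⟨a, rfl⟩ := hk
          simp [shiftFun_add, mul_left_comm]
        · simp [shiftFun, Function.extend_apply' _ _ _ hk] }
    ‖w‖ fun f => by
      obtain ⟨s, hs, hle⟩ := shiftFun_hasSum w e f
      refine lp.norm_le_of_tsum_le (by norm_num) (by positivity) ?_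
      simpa [hs.tsum_eq] using (by simpa using hs.tsum_eq.le.trans hle)

/-- The defining property of the weighted shift on the canonical orthonormal basis. -/
theorem weightedShift_single (w : WeightFamily) (e k : ℕ × ℕ) :
    weightedShift w e (lp.single 2 k (1 : ℂ)) = (w k : ℂ) • lp.single 2 (k + e) (1 : ℂ) := by
  ext j
  change shiftFun w e (lp.single 2 k (1 : ℂ)) j =
    (w k : ℂ) * (lp.single 2 (k + e) (1 : ℂ) : EllTwo) j
  by_cases hj : ∃ a, a + e = j
  · obtain ⟨a, rfl⟩ := hj
    by_cases hak : a = k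
    · subst hak
      simp [shiftFun_add]
    · simp [shiftFun_add, hak]
  · have hne : j ≠ k + e := fun h => hj ⟨k, h.symm⟩
    rw [shiftFun, Function.extend_apply' _ _ _ hj]
    simp [hne]

/-- The 2-variable weighted shift `(T₁, T₂)` with weights `α`, `β`:
`T₁ e_k = α_k e_{k + (1,0)}` and `T₂ e_k = β_k e_{k + (0,1)}`. -/
def twoVarShift (α β : WeightFamily) : Fin 2 → (EllTwo →L[ℂ] EllTwo) :=
  ![weightedShift α (1, 0), weightedShift β (0, 1)]

/-- Horizontal flatness: `α_{(k₁,k₂)} = α_{(1,1)}` for all `k₁, k₂ ≥ 1`. -/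
def IsHorizontallyFlat (α : WeightFamily) : Prop :=
  ∀ k₁ k₂ : ℕ, 1 ≤ k₁ → 1 ≤ k₂ → α (k₁, k₂) = α (1, 1)

/-- Vertical flatness: `β_{(k₁,k₂)} = β_{(1,1)}` for all `k₁, k₂ ≥ 1`. -/
def IsVerticallyFlat (β : WeightFamily) : Prop :=
  ∀ k₁ k₂ : ℕ, 1 ≤ k₁ → 1 ≤ k₂ → β (k₁, k₂) = β (1, 1)

end

/-!
Write `a`, `b` for the horizontal and vertical weights, and consider horizontal flatness; exchanging
the coordinates (`ActsAsTwoVariableShift.swap`) gives vertical flatness.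

For a jointly hyponormal pair, three facts are combined in
`ActsAsTwoVariableShift.flat_of_isJointlyHyponormal`.

* Along a row, the quadratically hyponormal operator acts as a unilateral weighted shift. Choi's
  theorem (`ActsAsShift.flat_of_eq`) says that two equal weights, other than the first two, make it
  flat. Its proof expands the form of `[(T + s T²)*, T + s T²]` for small `s` at vectors supported
  on five consecutive basis vectors; the leading coefficient, a quadratic polynomial in two
  parameters of the vector, is nonnegative everywhere only if the equality propagates.
* At a point where `a` is stationary, the form of `[S*, S]` degenerates, so the off-diagonal entry
  of the positive operator matrix vanishes. Together with commutativity, this copies the equality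
  to the row above and makes the vertical weights there independent of the column
  (`ActsAsTwoVariableShift.eq_above_of_eq`).
* For the rows below, the columns are subnormal. The squared norms `‖Nᵐ x‖²` for a normal operator
  form a completely monotone sequence, and such a sequence is determined, except at `m = 0`, by any
  of its tails (`IsCompletelyMonotone.eq_of_eventually_eq`): a Berger measure is determined off the
  origin by its high moments. So columns which agree high up agree from the second weight on
  (`IsSubnormal.weights_eq_of_eventually_eq`).

For a jointly subnormal pair with normal extension `(N₀, N₁)`, equality of two weights is equality
in a Cauchy–Schwarz inequality, and makes the basis vector at `(k, l)` an eigenvector of `N₀* N₀`.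
By Fuglede's theorem `N₀* N₀` commutes with `N₁`, and powers of a normal operator have the same
kernel; hence all basis vectors at `(i, j)` with `i, j ≥ 1` are eigenvectors for the same eigenvalue
(`ActsAsTwoVariableShift.flat_of_isJointlySubnormal`).
-/

/-! ### Completely monotone sequences -/

/-- The iterated differences of a real sequence `g`, scaled by `c`: one step sends `g` to
`m ↦ g m - c * g (m + 1)`. For the moments `g m = ∫ tᵐ dμ` of a measure, the value at `j`, `m` is
`∫ tᵐ (1 - c t)ʲ dμ`. -/
def scaledDiff (c : ℝ) (g : ℕ → ℝ) : ℕ → ℕ → ℝ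
  | 0 => g
  | j + 1 => fun m => scaledDiff c g j m - c * scaledDiff c g j (m + 1)

/-- `g` is completely monotone with scale `c`: all its scaled differences are nonnegative. By
Hausdorff's theorem these are the moment sequences of the measures on `[0, 1 / c]`. -/
def IsCompletelyMonotone (c : ℝ) (g : ℕ → ℝ) : Prop :=
  ∀ j m, 0 ≤ scaledDiff c g j m

theorem scaledDiff_const_mul (c r : ℝ) (g : ℕ → ℝ) (j m : ℕ) :
    scaledDiff c (fun m => r * g m) j m = r * scaledDiff c g j m := by
  induction j generalizing m with
  | zero => rfl
  | succ j ih => simp only [scaledDiff, ih]; ring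

theorem IsCompletelyMonotone.const_mul {c r : ℝ} {g : ℕ → ℝ} (hg : IsCompletelyMonotone c g)
    (hr : 0 ≤ r) : IsCompletelyMonotone c fun m => r * g m := fun j m => by
  rw [scaledDiff_const_mul]
  exact mul_nonneg hr (hg j m)

/-- For moments of `μ` this says `∫ tᵐ⁺¹ (1 - c t)ʲ dμ → 0`. It fails at exponent `0` in place of
`m + 1`, where the limit is the mass of `μ` at the origin. -/
theorem IsCompletelyMonotone.tendsto_scaledDiff {c : ℝ} (hc : 0 < c) {g : ℕ → ℝ}
    (hg : IsCompletelyMonotone c g) (m : ℕ) :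
    Filter.Tendsto (fun j => scaledDiff c g j (m + 1)) Filter.atTop (nhds 0) := by
  have hanti : Antitone fun j => scaledDiff c g j m := antitone_nat_of_succ_le fun j => by
    have := mul_nonneg hc.le (hg j (m + 1))
    simp only [scaledDiff]
    linarith
  have hbdd : BddBelow (Set.range fun j => scaledDiff c g j m) :=
    ⟨0, by rintro _ ⟨j, rfl⟩; exact hg j m⟩
  have hlim := tendsto_atTop_ciInf hanti hbdd
  have := ((hlim.sub (hlim.comp (Filter.tendsto_add_atTop_nat 1))).const_mul c⁻¹)
  rw [sub_self, mul_zero] at this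
  refine this.congr fun j => ?_
  simp only [Function.comp, scaledDiff]
  field_simp
  ring

/-- A tail of a completely monotone sequence determines all its terms except the one of index `0`:
a measure on `[0, 1 / c]` is determined, off the origin, by its moments of high order. -/
theorem IsCompletelyMonotone.eq_of_eventually_eq {c : ℝ} (hc : 0 < c) {g h : ℕ → ℝ}
    (hg : IsCompletelyMonotone c g) (hh : IsCompletelyMonotone c h) {n : ℕ}
    (hgh : ∀ m, n ≤ m → g m = h m) {m : ℕ} (hm : 1 ≤ m) : g m = h m := by
  induction n with
  | zero => exact hgh m m.zero_le
  | succ n ih =>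
    rcases Nat.eq_zero_or_pos n with rfl | hn
    · exact hgh m hm
    obtain ⟨n, rfl⟩ := Nat.exists_eq_add_of_le' hn
    have htail : ∀ j m, n + 1 + 1 ≤ m → scaledDiff c g j m = scaledDiff c h j m := by
      intro j
      induction j with
      | zero => exact hgh
      | succ j ihj =>
        intro m hm
        simp only [scaledDiff, ihj m hm, ihj (m + 1) (by lia)]
    -- The `j`-th differences at `n + 1` differ from the terms there by combinations of later terms.
    have hdiff : ∀ j, scaledDiff c g j (n + 1) - scaledDiff c h j (n + 1) =
        g (n + 1) - h (n + 1) := by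
      intro j
      induction j with
      | zero => rfl
      | succ j ihj =>
        simp only [scaledDiff, htail j (n + 1 + 1) le_rfl]
        linarith
    have hlim := (hg.tendsto_scaledDiff hc n).sub (hh.tendsto_scaledDiff hc n)
    simp only [hdiff, sub_zero] at hlim
    have hn1 : g (n + 1) = h (n + 1) :=
      sub_eq_zero.mp (tendsto_nhds_unique tendsto_const_nhds hlim)
    exact ih fun k hk => (Nat.eq_or_lt_of_le hk).elim (fun e => e ▸ hn1) (hgh k)

/-! ### Normal operators -/

section Normal

open ContinuousLinearMap

variable {K : Type*} [NormedAddCommGroup K] [InnerProductSpace ℂ K] [CompleteSpace K]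

/-- With `A = 1 - c N* N`, the scaled differences of `m ↦ ‖Nᵐ x‖²` are `⟪Aʲ Nᵐ x, Nᵐ x⟫`. -/
theorem isCompletelyMonotone_norm_pow_apply {N : K →L[ℂ] K} (hN : IsStarNormal N) {c : ℝ}
    (hc : 0 ≤ c) (hcN : c * ‖N‖ ^ 2 ≤ 1) (x : K) :
    IsCompletelyMonotone c fun m => ‖(N ^ m) x‖ ^ 2 := by
  set A : K →L[ℂ] K := 1 - (c : ℂ) • (adjoint N * N) with hA
  have hcomm : Commute N A := by
    have h : Commute N (adjoint N) := hN.star_comm_self.symm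
    exact (Commute.one_right N).sub_right ((h.mul_right (Commute.refl N)).smul_right _)
  have hAinner : ∀ u v : K, inner ℂ u (A v) = inner ℂ u v - c * inner ℂ (N u) (N v) := by
    intro u v
    simp [hA, adjoint_inner_right]
  have hApos : (0 : K →L[ℂ] K) ≤ A := by
    rw [nonneg_iff_isPositive, isPositive_iff_complex]
    intro u
    have h : inner ℂ (A u) u = ((‖u‖ ^ 2 - c * ‖N u‖ ^ 2 : ℝ) : ℂ) := by
      rw [← inner_conj_symm, hAinner, inner_self_eq_norm_sq_to_K, inner_self_eq_norm_sq_to_K]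
      simp [← Complex.ofReal_pow]
    have hle : c * ‖N u‖ ^ 2 ≤ ‖u‖ ^ 2 := by
      calc c * ‖N u‖ ^ 2 ≤ c * (‖N‖ * ‖u‖) ^ 2 := by gcongr; exact N.le_opNorm u
        _ = c * ‖N‖ ^ 2 * ‖u‖ ^ 2 := by ring
        _ ≤ 1 * ‖u‖ ^ 2 := by gcongr
        _ = ‖u‖ ^ 2 := one_mul _
    rw [h]
    exact ⟨by simp only [RCLike.re_to_complex, Complex.ofReal_re], by
      simpa only [RCLike.re_to_complex, Complex.ofReal_re, sub_nonneg] using hle⟩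
  have key : ∀ j m, (scaledDiff c (fun m => ‖(N ^ m) x‖ ^ 2) j m : ℂ) =
      inner ℂ ((N ^ m) x) ((A ^ j) ((N ^ m) x)) := by
    intro j
    induction j with
    | zero => intro m; simp [scaledDiff, inner_self_eq_norm_sq_to_K]
    | succ j ih =>
      intro m
      have h : N ((A ^ j) ((N ^ m) x)) = (A ^ j) ((N ^ (m + 1)) x) := by
        rw [pow_succ' N]
        exact congr($((hcomm.pow_right j).eq) ((N ^ m) x))
      rw [pow_succ' A, mul_apply_eq_comp, hAinner, h, ← ih]
      rw [show N ((N ^ m) x) = (N ^ (m + 1)) x by rw [pow_succ']; rfl, ← ih]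
      simp [scaledDiff]
  intro j m
  have hpos := ((nonneg_iff_isPositive _).mp (CStarAlgebra.pow_nonneg hApos j)).inner_nonneg_right
    ((N ^ m) x)
  rw [← key] at hpos
  exact_mod_cast hpos

theorem apply_eq_zero_of_pow_apply_eq_zero {N : K →L[ℂ] K} (hN : IsStarNormal N) {n : ℕ} {u : K}
    (h : (N ^ (n + 1)) u = 0) : N u = 0 := by
  induction n with
  | zero => simpa using h
  | succ n ih =>
    apply ih
    rw [pow_succ', mul_apply_eq_comp, pow_succ', mul_apply_eq_comp] at h
    rw [pow_succ', mul_apply_eq_comp]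
    rw [← hN.adjoint_apply_eq_zero_iff] at h
    have := adjoint_inner_left N ((N ^ n) u) (N ((N ^ n) u))
    rw [h, inner_zero_left] at this
    exact inner_self_eq_zero.mp this.symm

/-- The case of equality in the Cauchy–Schwarz inequality `‖N v‖⁴ ≤ ‖N² v‖² ‖v‖²`. -/
theorem adjoint_mul_self_apply_eq_smul {N : K →L[ℂ] K} (hN : IsStarNormal N) {v : K} {c : ℝ}
    (h1 : ‖N v‖ ^ 2 = c * ‖v‖ ^ 2) (h2 : ‖N (N v)‖ ^ 2 = c * ‖N v‖ ^ 2) :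
    adjoint N (N v) = (c : ℂ) • v := by
  rw [← sub_eq_zero, ← norm_eq_zero, ← sq_eq_zero_iff, @norm_sub_sq ℂ]
  have h3 : ‖adjoint N (N v)‖ = ‖N (N v)‖ := (isStarNormal_iff_norm_eq_adjoint.mp hN _).symm
  rw [h3, h2, inner_smul_right, adjoint_inner_left, inner_self_eq_norm_sq_to_K, norm_smul, mul_pow]
  simp [← Complex.ofReal_pow, ← Complex.ofReal_mul, h1]
  ring

end Normal

/-! ### Quadratically hyponormal unilateral shifts -/

section QuadraticallyHyponormal

open ContinuousLinearMap

variable {H : Type*} [NormedAddCommGroup H] [InnerProductSpace ℂ H]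

theorem norm_sq_sum_of_pairwise_orthogonal {u : Fin 6 → H}
    (hu : Pairwise fun i j => inner ℂ (u i) (u j) = 0) (d : Fin 6 → ℝ) :
    ‖∑ i, (d i : ℂ) • u i‖ ^ 2 = ∑ i, d i ^ 2 * ‖u i‖ ^ 2 := by
  have h : inner ℂ (∑ i, (d i : ℂ) • u i) (∑ i, (d i : ℂ) • u i) =
      ((∑ i, d i ^ 2 * ‖u i‖ ^ 2 : ℝ) : ℂ) := by
    rw [sum_inner]
    push_cast
    refine Finset.sum_congr rfl fun i _ => ?_
    rw [inner_sum, Finset.sum_eq_single i]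
    · rw [inner_smul_left, inner_smul_right, inner_self_eq_norm_sq_to_K, Complex.conj_ofReal]
      simp only [Complex.coe_algebraMap]
      ring
    · intro j _ hji
      rw [inner_smul_left, inner_smul_right, hu hji.symm, mul_zero, mul_zero]
    · simp
  rw [inner_self_eq_norm_sq_to_K] at h
  exact Complex.ofReal_injective (by simpa using h)

variable [CompleteSpace H]

/-- `T` and its adjoint act on the orthonormal sequence `f` as the unilateral weighted shift with
weight sequence `a` and its adjoint. -/
structure ActsAsShift (T : H →L[ℂ] H) (f : ℕ → H) (a : ℕ → ℝ) : Prop where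
  orthonormal : Orthonormal ℂ f
  apply (j : ℕ) : T (f j) = (a j : ℂ) • f (j + 1)
  adjoint_apply_zero : adjoint T (f 0) = 0
  adjoint_apply_succ (j : ℕ) : adjoint T (f (j + 1)) = (a j : ℂ) • f j

theorem IsHyponormal.norm_adjoint_apply_sq_le {S : H →L[ℂ] H} (hS : IsHyponormal S) (x : H) :
    ‖adjoint S x‖ ^ 2 ≤ ‖S x‖ ^ 2 := by
  have h := hS.re_inner_nonneg_right x
  rw [opComm, sub_apply, mul_apply_eq_comp, mul_apply_eq_comp, inner_sub_right, map_sub,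
    adjoint_inner_right, ← adjoint_inner_left S (adjoint S x) x, inner_self_eq_norm_sq,
    inner_self_eq_norm_sq] at h
  linarith

theorem IsQuadraticallyHyponormal.norm_adjoint_add_sq_le {T : H →L[ℂ] H}
    (hT : IsQuadraticallyHyponormal T) (s : ℝ) (x : H) :
    ‖adjoint T x + (s : ℂ) • adjoint T (adjoint T x)‖ ^ 2 ≤ ‖T x + (s : ℂ) • T (T x)‖ ^ 2 := by
  have hdeg : (Polynomial.X + Polynomial.C (s : ℂ) * Polynomial.X ^ 2 : Polynomial ℂ).natDegree
      ≤ 2 := by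
    compute_degree
  have h := (hT _ hdeg).norm_adjoint_apply_sq_le x
  have haeval : Polynomial.aeval T (Polynomial.X + Polynomial.C (s : ℂ) * Polynomial.X ^ 2) =
      T + (s : ℂ) • T ^ 2 := by
    simp [Algebra.smul_def]
  have hadj : adjoint (T + (s : ℂ) • T ^ 2) = adjoint T + (s : ℂ) • adjoint T ^ 2 := by
    simp [← star_eq_adjoint, star_smul]
  rw [haeval, hadj] at h
  simpa [pow_two] using h

/-- The second-order condition at two equal weights `b 0 = b 1` of a quadratically hyponormal
shift. It comes from testing the hyponormality of `T + s T²` on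
`g₁ - s b₀ (g₀ + g₂) + s² (y g₋₁ + w g₃)`: for small `s` the terms of lower order than `s⁴` cancel.
Indexing by `ℤ` lets a unilateral shift be treated as a bilateral one, with zero vectors and zero
weights at the negative indices. -/
theorem IsQuadraticallyHyponormal.second_order_nonneg {T : H →L[ℂ] H}
    (hT : IsQuadraticallyHyponormal T) {g : ℤ → H} {b : ℤ → ℝ}
    (hg : Pairwise fun i j => inner ℂ (g i) (g j) = 0) (hg1 : ∀ j, 0 ≤ j → ‖g j‖ = 1)
    (hgb : ∀ j, b j = 0 ∨ ‖g j‖ = 1) (hTg : ∀ j, T (g j) = (b j : ℂ) • g (j + 1))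
    (hTg' : ∀ j, adjoint T (g (j + 1)) = (b j : ℂ) • g j) (hb : b 1 = b 0) (y w : ℝ) :
    0 ≤ b 0 ^ 2 * (b 0 ^ 4 - b (-1) ^ 2 * b (-2) ^ 2)
        - 2 * b 0 * b (-1) * (b 0 ^ 2 - b (-2) ^ 2) * y + (b (-1) ^ 2 - b (-2) ^ 2) * y ^ 2
      + (b 0 ^ 2 * (b 2 ^ 2 * b 3 ^ 2 - b 0 ^ 4)
        - 2 * b 0 * b 2 * (b 3 ^ 2 - b 0 ^ 2) * w + (b 3 ^ 2 - b 2 ^ 2) * w ^ 2) := by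
  set E := b 0 ^ 2 * (b 0 ^ 4 - b (-1) ^ 2 * b (-2) ^ 2)
        - 2 * b 0 * b (-1) * (b 0 ^ 2 - b (-2) ^ 2) * y + (b (-1) ^ 2 - b (-2) ^ 2) * y ^ 2
      + (b 0 ^ 2 * (b 2 ^ 2 * b 3 ^ 2 - b 0 ^ 4)
        - 2 * b 0 * b 2 * (b 3 ^ 2 - b 0 ^ 2) * w + (b 3 ^ 2 - b 2 ^ 2) * w ^ 2) with hE
  set F := (b (-1) ^ 2 * b 0 ^ 2 - b (-2) ^ 2 * b (-3) ^ 2) * y ^ 2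
      + (b 3 ^ 2 * b 4 ^ 2 - b 0 ^ 2 * b 2 ^ 2) * w ^ 2 with hF
  have main : ∀ s : ℝ, 0 ≤ s ^ 4 * (E + s ^ 2 * F) := by
    intro s
    set x : H := ((s ^ 2 * y : ℝ) : ℂ) • g (-1) + ((-(s * b 0) : ℝ) : ℂ) • g 0 + g 1
      + ((-(s * b 0) : ℝ) : ℂ) • g 2 + ((s ^ 2 * w : ℝ) : ℂ) • g 3 with hx
    have h := hT.norm_adjoint_add_sq_le s x
    have up : ∀ j k, j + 1 = k → T (g j) = (b j : ℂ) • g k := fun j k h => h ▸ hTg j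
    have down : ∀ j k, j + 1 = k → adjoint T (g k) = (b j : ℂ) • g j := fun j k h => h ▸ hTg' j
    have t1 : T (g (-1)) = (b (-1) : ℂ) • g 0 := up _ _ (by norm_num)
    have t2 : T (g 0) = (b 0 : ℂ) • g 1 := up _ _ (by norm_num)
    have t3 : T (g 1) = (b 1 : ℂ) • g 2 := up _ _ (by norm_num)
    have t4 : T (g 2) = (b 2 : ℂ) • g 3 := up _ _ (by norm_num)
    have t5 : T (g 3) = (b 3 : ℂ) • g 4 := up _ _ (by norm_num)
    have t6 : T (g 4) = (b 4 : ℂ) • g 5 := up _ _ (by norm_num)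
    have a0 : adjoint T (g (-2)) = (b (-3) : ℂ) • g (-3) := down _ _ (by norm_num)
    have a1 : adjoint T (g (-1)) = (b (-2) : ℂ) • g (-2) := down _ _ (by norm_num)
    have a2 : adjoint T (g 0) = (b (-1) : ℂ) • g (-1) := down _ _ (by norm_num)
    have a3 : adjoint T (g 1) = (b 0 : ℂ) • g 0 := down _ _ (by norm_num)
    have a4 : adjoint T (g 2) = (b 1 : ℂ) • g 1 := down _ _ (by norm_num)
    have a5 : adjoint T (g 3) = (b 2 : ℂ) • g 2 := down _ _ (by norm_num)
    set C : Fin 6 → ℝ :=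
      ![b (-1) * (s ^ 2 * y), b 0 * (-(s * b 0)) + s * (b 0 * b (-1) * (s ^ 2 * y)),
        b 0 + s * (b 0 * b 0 * (-(s * b 0))), b 2 * (-(s * b 0)) + s * (b 2 * b 0),
        b 3 * (s ^ 2 * w) + s * (b 3 * b 2 * (-(s * b 0))), s * (b 4 * b 3 * (s ^ 2 * w))] with hC
    set D : Fin 6 → ℝ :=
      ![b (-3) * (s * (b (-2) * (s ^ 2 * y))),
        b (-2) * (s ^ 2 * y + s * (b (-1) * (-(s * b 0)))),
        b (-1) * (-(s * b 0) + s * b 0), b 0 * (1 + s * (b 0 * (-(s * b 0)))),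
        b 0 * (-(s * b 0) + s * (b 2 * (s ^ 2 * w))), b 2 * (s ^ 2 * w)] with hD
    have hup : T x + (s : ℂ) • T (T x) = ∑ i : Fin 6, (C i : ℂ) • g ((i : ℕ) : ℤ) := by
      simp only [hx, map_add, map_smul, t1, t2, t3, t4, t5, t6, hb, smul_add, smul_smul]
      simp [Fin.sum_univ_six, hC]
      module
    have hdown : adjoint T x + (s : ℂ) • adjoint T (adjoint T x) =
        ∑ i : Fin 6, (D i : ℂ) • g ((i : ℕ) - 3 : ℤ) := by
      simp only [hx, map_add, map_smul, a0, a1, a2, a3, a4, a5, hb, smul_add, smul_smul]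
      simp [Fin.sum_univ_six, hD]
      module
    rw [hup, hdown,
      norm_sq_sum_of_pairwise_orthogonal (fun i j hij => hg (by simpa [Fin.val_inj] using hij)),
      norm_sq_sum_of_pairwise_orthogonal (fun i j hij => hg (by simpa [Fin.val_inj] using hij))] at h
    have hdrop : ∀ j z, (b j * z) ^ 2 * ‖g j‖ ^ 2 = (b j * z) ^ 2 := by
      intro j z
      rcases hgb j with h0 | h1
      · simp [h0]
      · simp [h1]
    simp [Fin.sum_univ_six, hC, hD, hg1, hdrop] at h
    linarith
  have hlim : Filter.Tendsto (fun s : ℝ => E + s ^ 2 * F) (nhdsWithin 0 (Set.Ioi 0)) (nhds E) := by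
    have : ContinuousAt (fun s : ℝ => E + s ^ 2 * F) 0 := by fun_prop
    simpa using this.tendsto.mono_left nhdsWithin_le_nhds
  refine ge_of_tendsto hlim ?_
  filter_upwards [self_mem_nhdsWithin] with s hs
  exact nonneg_of_mul_nonneg_right (main s) (pow_pos hs 4)

end QuadraticallyHyponormal

section Choi

open ContinuousLinearMap

variable {H : Type*} [NormedAddCommGroup H] [InnerProductSpace ℂ H] [CompleteSpace H]

/-- The condition of `IsQuadraticallyHyponormal.second_order_nonneg` for a unilateral shift, centred
at the equal weights `a (n + 1) = a (n + 2)`. For `n = 0` the weight `r` at the index `n - 1` is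
missing and counts as `0`. -/
theorem ActsAsShift.second_order_nonneg {T : H →L[ℂ] H} {f : ℕ → H} {a : ℕ → ℝ}
    (hf : ActsAsShift T f a) (hT : IsQuadraticallyHyponormal T) {n : ℕ}
    (ha : a (n + 2) = a (n + 1)) {r : ℝ} (hr : r = if n = 0 then 0 else a (n - 1)) (y w : ℝ) :
    0 ≤ a (n + 1) ^ 2 * (a (n + 1) ^ 4 - a n ^ 2 * r ^ 2)
        - 2 * a (n + 1) * a n * (a (n + 1) ^ 2 - r ^ 2) * y + (a n ^ 2 - r ^ 2) * y ^ 2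
      + (a (n + 1) ^ 2 * (a (n + 3) ^ 2 * a (n + 4) ^ 2 - a (n + 1) ^ 4)
        - 2 * a (n + 1) * a (n + 3) * (a (n + 4) ^ 2 - a (n + 1) ^ 2) * w
        + (a (n + 4) ^ 2 - a (n + 3) ^ 2) * w ^ 2) := by
  set N : ℤ := n + 1 with hN
  set g : ℤ → H := fun j => if 0 ≤ j + N then f (j + N).toNat else 0 with hg
  set b : ℤ → ℝ := fun j => if 0 ≤ j + N then a (j + N).toNat else 0 with hb
  have hg_nonneg : ∀ (j : ℤ) (k : ℕ), j + N = k → g j = f k ∧ b j = a k := by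
    intro j k h
    simp [hg, hb, h]
  have hg_neg : ∀ j : ℤ, j + N < 0 → g j = 0 ∧ b j = 0 := by
    intro j h
    simp [hg, hb, not_le.mpr h]
  have hcases : ∀ j : ℤ, j + N < 0 ∨ ∃ k : ℕ, j + N = k := fun j => by
    rcases lt_or_ge (j + N) 0 with h | h
    · exact Or.inl h
    · exact Or.inr ⟨_, (Int.toNat_of_nonneg h).symm⟩
  have h := hT.second_order_nonneg (g := g) (b := b) ?_ ?_ ?_ ?_ ?_ ?_ y w
  · have h2 : b (-2) = r := by
      rcases n with _ | n
      · rw [hr, if_pos rfl]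
        exact (hg_neg (-2) (by simp [hN])).2
      · rw [hr, if_neg (by simp)]
        exact (hg_nonneg (-2) n (by simp [hN]; ring)).2
    rwa [h2, (hg_nonneg (-1) n (by simp [hN])).2, (hg_nonneg 0 (n + 1) (by simp [hN])).2,
      (hg_nonneg 2 (n + 3) (by simp [hN]; ring)).2,
      (hg_nonneg 3 (n + 4) (by simp [hN]; ring)).2] at h
  · intro i j hij
    rcases hcases i with hi | ⟨k, hi⟩
    · simp [hg_neg i hi]
    rcases hcases j with hj | ⟨l, hj⟩
    · simp [hg_neg j hj]
    rw [(hg_nonneg i k hi).1, (hg_nonneg j l hj).1]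
    exact hf.orthonormal.2 (by lia)
  · intro j hj
    obtain ⟨k, hk⟩ := Int.eq_ofNat_of_zero_le (a := j + N) (by lia)
    rw [(hg_nonneg j k hk).1]
    exact hf.orthonormal.1 k
  · intro j
    rcases hcases j with hj | ⟨k, hk⟩
    · exact Or.inl (hg_neg j hj).2
    · rw [(hg_nonneg j k hk).1]
      exact Or.inr (hf.orthonormal.1 k)
  · intro j
    rcases hcases j with hj | ⟨k, hk⟩
    · simp [hg_neg j hj]
    · rw [(hg_nonneg j k hk).1, (hg_nonneg j k hk).2, (hg_nonneg (j + 1) (k + 1) (by lia)).1]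
      exact hf.apply k
  · intro j
    rcases hcases j with hj | ⟨k, hk⟩
    · rw [(hg_neg j hj).2, (hg_neg j hj).1]
      rcases hcases (j + 1) with hj' | ⟨l, hl⟩
      · simp [hg_neg (j + 1) hj']
      · obtain rfl : l = 0 := by lia
        rw [(hg_nonneg (j + 1) 0 hl).1, hf.adjoint_apply_zero, smul_zero]
    · rw [(hg_nonneg j k hk).1, (hg_nonneg j k hk).2, (hg_nonneg (j + 1) (k + 1) (by lia)).1]
      exact hf.adjoint_apply_succ k
  · rw [(hg_nonneg 1 (n + 2) (by simp [hN]; ring)).2, (hg_nonneg 0 (n + 1) (by simp [hN])).2, ha]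

/-- Two equal weights of a quadratically hyponormal shift, other than the first two, propagate one
step to each side, except to the first weight. The test parameter `y` makes the part of the
second-order condition that comes from the left nonpositive, so the discriminant of the part in
`w` gives the equality on the right; this annihilates the latter part at a suitable `w`, and the
equality on the left follows. -/
theorem ActsAsShift.eq_of_eq {T : H →L[ℂ] H} {f : ℕ → H} {a : ℕ → ℝ}
    (hf : ActsAsShift T f a) (hT : IsQuadraticallyHyponormal T) (hpos : ∀ j, 0 < a j) {n : ℕ}
    (ha : a (n + 2) = a (n + 1)) : a (n + 3) = a (n + 1) ∧ (n ≠ 0 → a n = a (n + 1)) := by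
  set r : ℝ := if n = 0 then 0 else a (n - 1) with hr
  have key := hf.second_order_nonneg hT ha hr
  have hp := hpos n
  have hc := hpos (n + 1)
  have hq := hpos (n + 3)
  have hm := hpos (n + 4)
  set p := a n
  set c := a (n + 1)
  set q := a (n + 3)
  set m := a (n + 4)
  have hleft : c ^ 2 * (c ^ 4 - p ^ 2 * r ^ 2) - 2 * c * p * (c ^ 2 - r ^ 2) * (c ^ 3 / p)
      + (p ^ 2 - r ^ 2) * (c ^ 3 / p) ^ 2 = -(c ^ 2 * r ^ 2 / p ^ 2 * (p ^ 2 - c ^ 2) ^ 2) := by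
    field_simp
    ring
  have hleft_nonneg : 0 ≤ c ^ 2 * r ^ 2 / p ^ 2 * (p ^ 2 - c ^ 2) ^ 2 := by positivity
  have hqc : q = c := by
    have hdisc := discrim_le_zero (a := m ^ 2 - q ^ 2) (b := -(2 * c * q * (m ^ 2 - c ^ 2)))
      (c := c ^ 2 * (q ^ 2 * m ^ 2 - c ^ 4)) fun w => by
        have := key (c ^ 3 / p) w
        rw [hleft] at this
        linarith
    have h : (c ^ 2 * m ^ 2) * (q ^ 2 - c ^ 2) ^ 2 ≤ 0 := by
      rw [discrim] at hdisc
      linarith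
    have h0 : (q ^ 2 - c ^ 2) ^ 2 = 0 :=
      le_antisymm (nonpos_of_mul_nonpos_right h (by positivity)) (sq_nonneg _)
    exact (sq_eq_sq₀ hq.le hc.le).mp (sub_eq_zero.mp (pow_eq_zero_iff two_ne_zero |>.mp h0))
  refine ⟨hqc, fun hn => ?_⟩
  have hrpos : 0 < r := by
    rw [hr, if_neg hn]
    exact hpos _
  have h := key (c ^ 3 / p) (c ^ 2)
  rw [hleft, hqc] at h
  have h' : (c ^ 2 * r ^ 2 / p ^ 2) * (p ^ 2 - c ^ 2) ^ 2 ≤ 0 := by linarith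
  have h0 : (p ^ 2 - c ^ 2) ^ 2 = 0 :=
    le_antisymm (nonpos_of_mul_nonpos_right h' (by positivity)) (sq_nonneg _)
  exact (sq_eq_sq₀ hp.le hc.le).mp (sub_eq_zero.mp (pow_eq_zero_iff two_ne_zero |>.mp h0))

/-- **Choi's theorem**: a quadratically hyponormal shift with two equal consecutive weights, other
than the first two, has all weights equal except possibly the first one. -/
theorem ActsAsShift.flat_of_eq {T : H →L[ℂ] H} {f : ℕ → H} {a : ℕ → ℝ}
    (hf : ActsAsShift T f a) (hT : IsQuadraticallyHyponormal T) (hpos : ∀ j, 0 < a j) {n : ℕ}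
    (hn : 1 ≤ n) (ha : a (n + 1) = a n) {j : ℕ} (hj : 1 ≤ j) : a j = a 1 := by
  obtain ⟨n, rfl⟩ := Nat.exists_eq_add_of_le' hn
  have h0 : a 2 = a 1 := by
    clear hn
    induction n with
    | zero => exact ha
    | succ n ih => exact ih ((hf.eq_of_eq hT hpos ha).2 n.succ_ne_zero).symm
  have hstep : ∀ k, a (k + 2) = a (k + 1) := by
    intro k
    induction k with
    | zero => exact h0
    | succ k ih => exact (hf.eq_of_eq hT hpos ih).1.trans ih.symm
  induction j, hj using Nat.le_induction with
  | base => rfl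
  | succ k hk ih =>
    obtain ⟨k, rfl⟩ := Nat.exists_eq_add_of_le' hk
    exact (hstep k).trans ih

end Choi

/-! ### Pairs acting as a two-variable weighted shift -/

section TwoVariable

open ContinuousLinearMap

universe u

variable {H : Type u} [NormedAddCommGroup H] [InnerProductSpace ℂ H]

theorem IsJointlySubnormal.swap {S R : H →L[ℂ] H} (h : IsJointlySubnormal ![S, R]) :
    IsJointlySubnormal ![R, S] := by
  obtain ⟨K, i1, i2, i3, N, V, hcomm, hN, hV⟩ := h
  refine ⟨K, i1, i2, i3, fun i => N (Equiv.swap 0 1 i), V, fun i j => hcomm _ _,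
    fun i => hN _, fun i x => ?_⟩
  have := hV (Equiv.swap 0 1 i) x
  fin_cases i <;> simpa using this

variable [CompleteSpace H]

theorem ActsAsShift.norm_pow_apply_zero {T : H →L[ℂ] H} {f : ℕ → H} {a : ℕ → ℝ}
    (hf : ActsAsShift T f a) (hpos : ∀ j, 0 < a j) (m : ℕ) :
    ‖(T ^ m) (f 0)‖ = ∏ l ∈ Finset.range m, a l := by
  have h : ∀ m, (T ^ m) (f 0) = ((∏ l ∈ Finset.range m, a l : ℝ) : ℂ) • f m := by
    intro m
    induction m with
    | zero => simp
    | succ m ih =>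
      rw [pow_succ', mul_apply_eq_comp, ih, map_smul, hf.apply, smul_smul, Finset.prod_range_succ]
      push_cast
      rfl
  rw [h, norm_smul, hf.orthonormal.1, mul_one, Complex.norm_real, Real.norm_of_nonneg]
  exact Finset.prod_nonneg fun l _ => (hpos l).le

/-- The tail of the weight sequence of a subnormal shift determines all its weights except the
first one. -/
theorem IsSubnormal.weights_eq_of_eventually_eq {T : H →L[ℂ] H} (hT : IsSubnormal T)
    {f f' : ℕ → H} {a a' : ℕ → ℝ} (hf : ActsAsShift T f a) (hf' : ActsAsShift T f' a')
    (hpos : ∀ j, 0 < a j) (hpos' : ∀ j, 0 < a' j) {n : ℕ} (h : ∀ m, n ≤ m → a m = a' m)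
    {m : ℕ} (hm : 1 ≤ m) : a m = a' m := by
  obtain ⟨K, _, _, _, N, V, hN, hV⟩ := hT
  have hVpow : ∀ m x, (N ^ m) (V x) = V ((T ^ m) x) := by
    intro m x
    induction m with
    | zero => rfl
    | succ m ih => rw [pow_succ', mul_apply_eq_comp, ih, hV, pow_succ', mul_apply_eq_comp]
  set c : ℝ := (‖N‖ ^ 2 + 1)⁻¹ with hc
  have hcpos : 0 < c := by positivity
  have hcN : c * ‖N‖ ^ 2 ≤ 1 := by
    rw [hc, inv_mul_le_one₀ (by positivity)]
    linarith
  set P : ℕ → ℝ := fun m => ∏ l ∈ Finset.range m, a l with hP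
  set P' : ℕ → ℝ := fun m => ∏ l ∈ Finset.range m, a' l with hP'
  have hPpos : ∀ m, 0 < P m := fun m => Finset.prod_pos fun l _ => hpos l
  have hPpos' : ∀ m, 0 < P' m := fun m => Finset.prod_pos fun l _ => hpos' l
  have hmono : IsCompletelyMonotone c fun m => P m ^ 2 := by
    simpa only [hVpow, V.norm_map, hf.norm_pow_apply_zero hpos] using
      isCompletelyMonotone_norm_pow_apply hN hcpos.le hcN (V (f 0))
  have hmono' : IsCompletelyMonotone c fun m => P' m ^ 2 := by
    simpa only [hVpow, V.norm_map, hf'.norm_pow_apply_zero hpos'] using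
      isCompletelyMonotone_norm_pow_apply hN hcpos.le hcN (V (f' 0))
  set s : ℝ := P n / P' n with hs
  have hspos : 0 < s := div_pos (hPpos n) (hPpos' n)
  have htail : ∀ m, n ≤ m → P m = s * P' m := by
    intro m hm
    induction m, hm using Nat.le_induction with
    | base => rw [hs, div_mul_cancel₀ _ (hPpos' n).ne']
    | succ m hm ih =>
      simp only [hP, hP', Finset.prod_range_succ] at ih ⊢
      rw [ih, h m hm, mul_assoc]
  have hall : ∀ m, 1 ≤ m → P m = s * P' m := by
    intro m hm
    have := hmono.eq_of_eventually_eq hcpos (hmono'.const_mul (sq_nonneg s))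
      (fun m hm => by rw [htail m hm, mul_pow]) hm
    rw [← mul_pow] at this
    exact (sq_eq_sq₀ (hPpos m).le (mul_pos hspos (hPpos' m)).le).mp this
  have h1 : P m * a m = s * (P' m * a' m) := by
    have := hall (m + 1) (by lia)
    simpa only [hP, hP', Finset.prod_range_succ] using this
  rw [hall m hm, ← mul_assoc] at h1
  exact mul_left_cancel₀ (mul_pos hspos (hPpos' m)).ne' h1

/-- The pair `(S, R)` acts on the unit vectors `f i j` as a two-variable weighted shift: `S` raises
`i` with weight `a i j`, and `R` raises `j` with weight `b i j`. Exchanging the indices exchanges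
the roles of `S` and `R`. -/
structure ActsAsTwoVariableShift (S R : H →L[ℂ] H) (f : ℕ → ℕ → H) (a b : ℕ → ℕ → ℝ) : Prop where
  row (j : ℕ) : ActsAsShift S (fun i => f i j) fun i => a i j
  column (i : ℕ) : ActsAsShift R (fun j => f i j) fun j => b i j
  pos_left (i j : ℕ) : 0 < a i j
  pos_right (i j : ℕ) : 0 < b i j

theorem IsJointlyHyponormal.swap {S R : H →L[ℂ] H} (h : IsJointlyHyponormal ![S, R]) :
    IsJointlyHyponormal ![R, S] := by
  refine ⟨fun i j => ?_, fun x => ?_⟩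
  · have := h.1 (Equiv.swap 0 1 i) (Equiv.swap 0 1 j)
    fin_cases i <;> fin_cases j <;> exact this
  · have := h.2 ![x 1, x 0]
    simp only [Fin.sum_univ_two, Matrix.cons_val_zero, Matrix.cons_val_one] at this ⊢
    rwa [add_comm, add_comm (opComm _ _ (x 1)), add_comm (opComm _ _ (x 1))] at this

/-- If the quadratic form of `[S*, S]` vanishes at `u`, so do the off-diagonal terms. -/
theorem IsJointlyHyponormal.re_cross_eq_zero {S R : H →L[ℂ] H} (h : IsJointlyHyponormal ![S, R])
    {u : H} (hu : ‖S u‖ = ‖adjoint S u‖) (v : H) :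
    (inner ℂ (R u) (S v)).re = (inner ℂ (adjoint S u) (adjoint R v)).re := by
  set B := (inner ℂ (R u) (S v)).re - (inner ℂ (adjoint S u) (adjoint R v)).re with hB
  set D := ‖R v‖ ^ 2 - ‖adjoint R v‖ ^ 2 with hD
  have hform : ∀ (X Y : H →L[ℂ] H) (x y : H), inner ℂ x (opComm (adjoint Y) X y) =
      inner ℂ (Y x) (X y) - inner ℂ (adjoint X x) (adjoint Y y) := by
    intro X Y x y
    rw [opComm, sub_apply, mul_apply_eq_comp, mul_apply_eq_comp, inner_sub_right,
      adjoint_inner_right, ← adjoint_inner_left X (adjoint Y y) x]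
  have hineq : ∀ t : ℝ, 0 ≤ D + 2 * B * t := by
    intro t
    have hpos := h.2 ![(t : ℂ) • u, v]
    simp only [Fin.sum_univ_two, Matrix.cons_val_zero, Matrix.cons_val_one, inner_add_right,
      hform, map_smul, inner_smul_left, inner_smul_right, Complex.conj_ofReal] at hpos
    have hre := (Complex.le_def.mp hpos).1
    have e1 : (inner ℂ (S v) (R u)).re = (inner ℂ (R u) (S v)).re := inner_re_symm (𝕜 := ℂ) _ _
    have e2 : (inner ℂ (adjoint R v) (adjoint S u)).re =
        (inner ℂ (adjoint S u) (adjoint R v)).re := inner_re_symm (𝕜 := ℂ) _ _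
    rw [inner_self_eq_norm_sq_to_K, inner_self_eq_norm_sq_to_K, inner_self_eq_norm_sq_to_K,
      inner_self_eq_norm_sq_to_K, hu] at hre
    simp [← Complex.ofReal_pow, e1, e2] at hre
    linarith
  have hB0 : B = 0 := by
    by_contra hne
    have := hineq (-(D + 1) / (2 * B))
    rw [mul_div_cancel₀ _ (by positivity)] at this
    linarith
  exact sub_eq_zero.mp hB0

namespace ActsAsTwoVariableShift

theorem swap {S R : H →L[ℂ] H} {f : ℕ → ℕ → H} {a b : ℕ → ℕ → ℝ}
    (h : ActsAsTwoVariableShift S R f a b) :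
    ActsAsTwoVariableShift R S (fun i j => f j i) (fun i j => b j i) fun i j => a j i :=
  ⟨h.column, h.row, fun i j => h.pos_right j i, fun i j => h.pos_left j i⟩

variable {S R : H →L[ℂ] H} {f : ℕ → ℕ → H} {a b : ℕ → ℕ → ℝ}

theorem commute_weights (h : ActsAsTwoVariableShift S R f a b) (hSR : Commute S R) (i j : ℕ) :
    a i (j + 1) * b i j = a i j * b (i + 1) j := by
  have h1 : S (R (f i j)) = R (S (f i j)) := congr($(hSR.eq) (f i j))
  have hne : f (i + 1) (j + 1) ≠ 0 := (h.row (j + 1)).orthonormal.ne_zero (i + 1)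
  rw [(h.row j).apply i, (h.column i).apply j, map_smul, map_smul, (h.row (j + 1)).apply i,
    (h.column (i + 1)).apply j, smul_smul, smul_smul] at h1
  have h2 := smul_left_injective ℂ hne h1
  rw [mul_comm]
  exact_mod_cast h2

theorem eq_above_of_eq (h : ActsAsTwoVariableShift S R f a b)
    (hSR : IsJointlyHyponormal ![S, R]) {i j : ℕ} (ha : a (i + 1) j = a i j) :
    a i (j + 1) = a i j ∧ b (i + 1) j = b i j := by
  have hc := h.commute_weights (hSR.1 0 1) i j
  have hu : ‖S (f (i + 1) j)‖ = ‖adjoint S (f (i + 1) j)‖ := by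
    rw [(h.row j).apply (i + 1), (h.row j).adjoint_apply_succ i, norm_smul, norm_smul, ha,
      (h.row j).orthonormal.1 (i + 1 + 1), (h.row j).orthonormal.1 i]
  have hx := hSR.re_cross_eq_zero hu (f i (j + 1))
  rw [(h.column (i + 1)).apply j, (h.row (j + 1)).apply i, (h.row j).adjoint_apply_succ i,
    (h.column i).adjoint_apply_succ j] at hx
  have n1 : ‖f (i + 1) (j + 1)‖ = 1 := (h.row (j + 1)).orthonormal.1 (i + 1)
  have n2 : ‖f i j‖ = 1 := (h.row j).orthonormal.1 i
  simp [inner_self_eq_norm_sq_to_K, n1, n2] at hx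
  have p1 := h.pos_left i j
  have p2 := h.pos_left i (j + 1)
  have p3 := h.pos_right i j
  have p4 := h.pos_right (i + 1) j
  -- Multiplying `hc` and `hx` leaves the squares of the horizontal weights.
  have haa : a i (j + 1) = a i j := by
    refine (sq_eq_sq₀ p2.le p1.le).mp (mul_right_cancel₀ (mul_pos p3 p4).ne' ?_)
    linear_combination a i (j + 1) * b (i + 1) j * hc + a i j * b (i + 1) j * hx
  refine ⟨haa, ?_⟩
  rw [haa] at hc
  exact (mul_left_cancel₀ p1.ne' hc).symm

/-- Equal horizontal weights in one row make all rows above it flat, by joint hyponormality. In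
these rows the vertical weights do not depend on the column, and subnormality of the columns
carries this down to the row `1`. -/
theorem flat_of_isJointlyHyponormal (h : ActsAsTwoVariableShift S R f a b)
    (hSR : IsJointlyHyponormal ![S, R]) (hS : IsQuadraticallyHyponormal S) (hR : IsSubnormal R)
    {k l : ℕ} (hk : 1 ≤ k) (ha : a (k + 1) l = a k l) {i j : ℕ} (hi : 1 ≤ i) (hj : 1 ≤ j) :
    a i j = a 1 1 := by
  have habove : ∀ j, l ≤ j → ∀ i, 1 ≤ i → a i j = a 1 l := by
    intro j hj
    induction j, hj using Nat.le_induction with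
    | base => exact fun i hi =>
        (h.row l).flat_of_eq hS (fun i => h.pos_left i l) hk ha hi
    | succ j _ ih => exact fun i hi =>
        (h.eq_above_of_eq hSR ((ih (i + 1) (by lia)).trans (ih i hi).symm)).1.trans (ih i hi)
  have hcol : ∀ i, 1 ≤ i → ∀ j, 1 ≤ j → b (i + 1) j = b i j := fun i hi j hj =>
    hR.weights_eq_of_eventually_eq (h.column (i + 1)) (h.column i) (h.pos_right (i + 1))
      (h.pos_right i) (n := l) (fun m hm => (h.eq_above_of_eq hSR
        ((habove m hm (i + 1) (by lia)).trans (habove m hm i hi).symm)).2) hj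
  have hvert : ∀ i, 1 ≤ i → ∀ j, 1 ≤ j → a i j = a i 1 := by
    intro i hi j hj
    induction j, hj using Nat.le_induction with
    | base => rfl
    | succ j hj ih =>
      have hc := h.commute_weights (hSR.1 0 1) i j
      rw [hcol i hi j hj] at hc
      exact (mul_right_cancel₀ (h.pos_right i j).ne' hc).trans ih
  have hconst : ∀ i, 1 ≤ i → a i 1 = a 1 l := fun i hi => by
    rw [← hvert i hi (l + 1) (by lia), habove (l + 1) (by lia) i hi]
  rw [hvert i hi j hj, hconst i hi, hconst 1 le_rfl]

/-- Equality of two weights means that `f k l` is an eigenvector of `N₀* N₀`, where `(N₀, N₁)` is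
the normal extension. By Fuglede's theorem this is the vanishing of `N₀ᵏ N₁ˡ` at the vector
`u = (N₀* N₀ - c) f 0 0`; since the kernels of the powers of a normal operator coincide, `N₀ N₁`
vanishes at `u`, so `f i j` is an eigenvector for all `i, j ≥ 1`. -/
theorem flat_of_isJointlySubnormal (h : ActsAsTwoVariableShift S R f a b)
    (hSR : IsJointlySubnormal ![S, R]) {k l : ℕ} (ha : a (k + 1) l = a k l) {i j : ℕ}
    (hi : 1 ≤ i) (hj : 1 ≤ j) : a i j = a 1 1 := by
  obtain ⟨K, _, _, _, N, V, hcomm, hN, hV⟩ := hSR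
  have hS : ∀ i j, N 0 (V (f i j)) = (a i j : ℂ) • V (f (i + 1) j) := fun i j => by
    rw [hV 0, ← V.map_smul]
    exact congrArg V ((h.row j).apply i)
  have hR : ∀ i j, N 1 (V (f i j)) = (b i j : ℂ) • V (f i (j + 1)) := fun i j => by
    rw [hV 1, ← V.map_smul]
    exact congrArg V ((h.column i).apply j)
  have hnorm : ∀ i j, ‖V (f i j)‖ = 1 := fun i j => by
    rw [V.norm_map]
    exact (h.row j).orthonormal.1 i
  have hSnorm : ∀ i j, ‖N 0 (V (f i j))‖ = a i j := fun i j => by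
    rw [hS, norm_smul, hnorm, mul_one, Complex.norm_real, Real.norm_of_nonneg (h.pos_left i j).le]
  have hpow : ∀ i j, ∃ t : ℂ, t ≠ 0 ∧ (N 0 ^ i * N 1 ^ j) (V (f 0 0)) = t • V (f i j) := by
    have hpow1 : ∀ j, ∃ t : ℂ, t ≠ 0 ∧ (N 1 ^ j) (V (f 0 0)) = t • V (f 0 j) := by
      intro j
      induction j with
      | zero => exact ⟨1, one_ne_zero, by simp⟩
      | succ j ih =>
        obtain ⟨t, ht, e⟩ := ih
        refine ⟨t * b 0 j, mul_ne_zero ht (by exact_mod_cast (h.pos_right 0 j).ne'), ?_⟩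
        rw [pow_succ', mul_apply_eq_comp, e, map_smul, hR, smul_smul]
    intro i j
    induction i with
    | zero => simpa using hpow1 j
    | succ i ih =>
      obtain ⟨t, ht, e⟩ := ih
      refine ⟨t * a i j, mul_ne_zero ht (by exact_mod_cast (h.pos_left i j).ne'), ?_⟩
      rw [pow_succ', mul_assoc, mul_apply_eq_comp, e, map_smul, hS, smul_smul]
  set c : ℝ := a k l ^ 2 with hc
  set Q : K →L[ℂ] K := adjoint (N 0) * N 0 - (c : ℂ) • 1 with hQ
  have hQ0 : Commute (N 0) Q :=
    ((hN 0).star_comm_self.symm.mul_right (Commute.refl _)).sub_right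
      ((Commute.one_right _).smul_right _)
  have hQ1 : Commute (N 1) Q :=
    (((hN 0).commute_star_right (hcomm 1 0)).mul_right (hcomm 1 0)).sub_right
      ((Commute.one_right _).smul_right _)
  have hmove : ∀ i j, (N 0 ^ i * N 1 ^ j) (Q (V (f 0 0))) = 0 ↔ Q (V (f i j)) = 0 := by
    intro i j
    obtain ⟨t, ht, e⟩ := hpow i j
    have hQ01 : Commute (N 0 ^ i * N 1 ^ j) Q := (hQ0.pow_left i).mul_left (hQ1.pow_left j)
    have hQe : (N 0 ^ i * N 1 ^ j) (Q (V (f 0 0))) = Q ((N 0 ^ i * N 1 ^ j) (V (f 0 0))) :=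
      congr($(hQ01.eq) (V (f 0 0)))
    rw [hQe, e, map_smul, smul_eq_zero_iff_right ht]
  have hkl : Q (V (f k l)) = 0 := by
    have := adjoint_mul_self_apply_eq_smul (hN 0) (v := V (f k l)) (c := c)
      (by rw [hSnorm, hnorm, hc]; ring)
      (by
        rw [hSnorm, hS, map_smul, norm_smul, hSnorm, ha, Complex.norm_real,
          Real.norm_of_nonneg (h.pos_left k l).le, hc]
        ring)
    simp [hQ, this]
  have h11 : (N 0 * N 1) (Q (V (f 0 0))) = 0 := by
    have h0 := (hmove k l).mpr hkl
    rw [mul_apply_eq_comp] at h0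
    have h1 : N 0 ((N 1 ^ l) (Q (V (f 0 0)))) = 0 :=
      apply_eq_zero_of_pow_apply_eq_zero (hN 0) (n := k) (by
        rw [pow_succ', mul_apply_eq_comp, h0, map_zero])
    have h2 : (N 1 ^ (l + 1)) (N 0 (Q (V (f 0 0)))) = 0 := by
      have e : (N 1 ^ l) (N 0 (Q (V (f 0 0)))) = N 0 ((N 1 ^ l) (Q (V (f 0 0)))) :=
        congr($(((hcomm 1 0).pow_left l).eq) (Q (V (f 0 0))))
      rw [pow_succ', mul_apply_eq_comp, e, h1, map_zero]
    rw [(hcomm 0 1).eq]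
    exact apply_eq_zero_of_pow_apply_eq_zero (hN 1) h2
  have heig : ∀ i j, 1 ≤ i → 1 ≤ j → a i j ^ 2 = c := by
    intro i j hi hj
    obtain ⟨i, rfl⟩ := Nat.exists_eq_add_of_le' hi
    obtain ⟨j, rfl⟩ := Nat.exists_eq_add_of_le' hj
    have e : N 0 ^ (i + 1) * N 1 ^ (j + 1) = N 0 ^ i * N 1 ^ j * (N 0 * N 1) := by
      rw [pow_succ, pow_succ, mul_assoc, mul_assoc, ← mul_assoc (N 0),
        ((hcomm 0 1).pow_right j).eq, mul_assoc]
    have hz : Q (V (f (i + 1) (j + 1))) = 0 :=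
      (hmove _ _).mp (by rw [e, mul_apply_eq_comp, h11, map_zero])
    have hin : inner ℂ (V (f (i + 1) (j + 1))) (Q (V (f (i + 1) (j + 1)))) =
        ((a (i + 1) (j + 1) ^ 2 - c : ℝ) : ℂ) := by
      simp only [hQ, sub_apply, smul_apply, one_apply_eq_self, mul_apply_eq_comp, inner_sub_right,
        inner_smul_right, adjoint_inner_right, inner_self_eq_norm_sq_to_K, hSnorm, hnorm]
      simp
    rw [hz, inner_zero_right] at hin
    exact sub_eq_zero.mp (by exact_mod_cast hin.symm)
  exact (sq_eq_sq₀ (h.pos_left i j).le (h.pos_left 1 1).le).mp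
    ((heig i j hi hj).trans (heig 1 1 le_rfl le_rfl).symm)

end ActsAsTwoVariableShift
end TwoVariable

/-! ### The shift on `ℓ²(ℤ₊²)` -/

section EllTwo

open ContinuousLinearMap

theorem adjoint_weightedShift_apply (w : WeightFamily) (e : ℕ × ℕ) (x : EllTwo) (k : ℕ × ℕ) :
    adjoint (weightedShift w e) x k = (w k : ℂ) * x (k + e) := by
  have h := adjoint_inner_right (weightedShift w e) (lp.single 2 k (1 : ℂ)) x
  rw [weightedShift_single, inner_smul_left, lp.inner_single_left, lp.inner_single_left] at h
  simpa using h

theorem orthonormal_single : Orthonormal ℂ fun k : ℕ × ℕ => (lp.single 2 k (1 : ℂ) : EllTwo) := by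
  rw [orthonormal_iff_ite]
  intro k l
  rw [lp.inner_single_left]
  by_cases h : k = l
  · simp [h]
  · simp [h]

/-- A weighted shift by `e` acts as a unilateral shift along an orbit `F` of `k ↦ k + e` which
starts outside the range of this map. -/
theorem actsAsShift_weightedShift (w : WeightFamily) {e : ℕ × ℕ} {F : ℕ → ℕ × ℕ}
    (hF : Function.Injective F) (hsucc : ∀ j, F (j + 1) = F j + e) (hzero : ∀ k, k + e ≠ F 0) :
    ActsAsShift (weightedShift w e) (fun j => lp.single 2 (F j) (1 : ℂ)) fun j => w (F j) where
  orthonormal := orthonormal_single.comp F hF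
  apply j := by rw [weightedShift_single, hsucc]
  adjoint_apply_zero := by
    ext k
    rw [adjoint_weightedShift_apply, lp.single_apply_ne _ _ _ (hzero k)]
    simp
  adjoint_apply_succ j := by
    ext k
    change _ = (w (F j) : ℂ) * (lp.single 2 (F j) (1 : ℂ) : EllTwo) k
    rw [adjoint_weightedShift_apply, hsucc]
    by_cases h : k = F j
    · simp [h]
    · simp [h]

theorem actsAsTwoVariableShift {α β : WeightFamily} (hα : ∀ k, 0 < α k) (hβ : ∀ k, 0 < β k) :
    ActsAsTwoVariableShift (weightedShift α (1, 0)) (weightedShift β (0, 1))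
      (fun i j => lp.single 2 (i, j) (1 : ℂ)) (fun i j => α (i, j)) fun i j => β (i, j) where
  row j := actsAsShift_weightedShift α (F := fun i => (i, j)) (fun _ _ h => congrArg Prod.fst h)
    (fun _ => rfl) fun _ h => Nat.succ_ne_zero _ (congrArg Prod.fst h)
  column i := actsAsShift_weightedShift β (F := fun j => (i, j))
    (fun _ _ h => congrArg Prod.snd h) (fun _ => rfl)
    fun _ h => Nat.succ_ne_zero _ (congrArg Prod.snd h)
  pos_left i j := hα (i, j)
  pos_right i j := hβ (i, j)

end EllTwo

theorem theorem4p5 (α β : WeightFamily) (hα : ∀ k, 0 < α k) (hβ : ∀ k, 0 < β k) :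
    -- commuting hyponormal pairs
    (IsJointlyHyponormal (twoVarShift α β) →
      -- `T₁` quadratically hyponormal, `T₂` subnormal
      (IsQuadraticallyHyponormal (twoVarShift α β 0) → IsSubnormal (twoVarShift α β 1) →
        (∃ k₁ k₂ : ℕ, 1 ≤ k₁ ∧ α (k₁ + 1, k₂) = α (k₁, k₂)) →
          IsHorizontallyFlat α) ∧
      -- `T₁` subnormal, `T₂` quadratically hyponormal
      (IsSubnormal (twoVarShift α β 0) → IsQuadraticallyHyponormal (twoVarShift α β 1) →
        (∃ k₁ k₂ : ℕ, 1 ≤ k₂ ∧ β (k₁, k₂ + 1) = β (k₁, k₂)) →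
          IsVerticallyFlat β)) ∧
    -- subnormal pairs
    (IsJointlySubnormal (twoVarShift α β) →
      ((∃ k₁ k₂ : ℕ, α (k₁ + 1, k₂) = α (k₁, k₂)) → IsHorizontallyFlat α) ∧
      ((∃ k₁ k₂ : ℕ, β (k₁, k₂ + 1) = β (k₁, k₂)) → IsVerticallyFlat β)) := by
  have h := actsAsTwoVariableShift hα hβ
  refine ⟨fun hT => ⟨?_, ?_⟩, fun hT => ⟨?_, ?_⟩⟩
  · rintro hS hR ⟨k, l, hk, ha⟩ i j hi hj
    exact h.flat_of_isJointlyHyponormal hT hS hR hk ha hi hj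
  · rintro hS hR ⟨k, l, hl, hb⟩ i j hi hj
    exact h.swap.flat_of_isJointlyHyponormal (IsJointlyHyponormal.swap hT) hR hS hl hb hj hi
  · rintro ⟨k, l, ha⟩ i j hi hj
    exact h.flat_of_isJointlySubnormal hT ha hi hj
  · rintro ⟨k, l, hb⟩ i j hi hj
    exact h.swap.flat_of_isJointlySubnormal (IsJointlySubnormal.swap hT) hb hj hi
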